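/- **Theorem 3 (Three noncollinear-projection active pursuers).** Three pursuers $P_1,P_2,P_3$ and one evader $E$ move in $\mathbb{R}^3$ with unit speed, $\dot{\mathbf x}_{P_i}=\mathbf p_i$, $\dot{\mathbf x}_E=\mathbf e$, where the controls $\mathbf p_i,\mathbf e$ are measurable functions of time $t\ge 0$ with values in the unit sphere. The evader is captured at time $t$ if $\mathbf x_E(t)=\mathbf x_{P_i}(t)$ for some $i$. Let $\mathcal T=\{z=0\}$, $\Omega_{\rm goal}=\{z<0\}$, $\Omega_{\rm play}=\{z>0\}$. Fix initial positions $\mathbf x_{P_i}^0\in\mathbb{R}^3$ of the pursuers; an initial position $\mathbf x_E^0$ of the evader is admissible if $\mathbf x_E^0\in\Omega_{\rm play}\setminus\{\mathbf x_{P_1}^0,\mathbf x_{P_2}^0,\mathbf x_{P_3}^0\}$. Define: - $\mathcal W_P$: the set of admissible $\mathbf x_E^0$ for which the pursuers have a non-anticipative strategy (a map from evader controls to pursuers' controls whose values on $[0,t]$ depend only on $\mathbf e|_{[0,t]}$, for all $t\ge0$, up to null sets) such that, for every evader control, whenever $E$ is in $\mathcal T$ at a time $t$, it has been captured at some time $s<t$;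 - $\mathcal W_E$: the set of admissible $\mathbf x_E^0$ for which the evader has a non-anticipative strategy with delay (a map from pursuers' controls to evader controls such that for some $\tau>0$ its values on $[0,t+\tau]$ depend only on the pursuers' controls on $[0,t]$, for all $t\ge0$, up to null sets) such that, for all pursuers' controls, there is a time $t\ge 0$ at which $E$ is in $\Omega_{\rm goal}$ and $E$ is not captured at any time in $[0,t]$; - $\mathcal B$ (the barrier): the set of admissible $\mathbf x_E^0$ that belong neither to $\mathcal W_P$ nor to $\mathcal W_E$. For two pursuers $P_i,P_j$ alone let $\mathcal W_P^{i,j}$ be the set defined as $\mathcal W_P$ in the game with only these two pursuers. Let $\bar{\mathbf x}_{P_i}^0=(x_{P_i}^0,y_{P_i}^0,0)$ and $\hat{\mathbf x}_{P_i}^0=(x_{P_i}^0,y_{P_i}^0,-z_{P_i}^0)$. Suppose that for all $i,j,k$ with $\{i,j,k\}=\{1,2,3\}$ $$(x_{P_i}^0-x_{P_j}^0)^2+(y_{P_i}^0-y_{P_j}^0)^2\neq0,\qquad \{\mathbf x_{P_k}^0,\hat{\mathbf x}_{P_k}^0\}\cap\mathcal W_P^{i,j}=\emptyset,$$ and that $\bar{\mathbf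 x}_{P_1}^0,\bar{\mathbf x}_{P_2}^0,\bar{\mathbf x}_{P_3}^0$ are not collinear. Let $S\subset\mathcal T$ be the closed triangle with these three vertices. Then there is a unique point $\mathbf c\in\mathcal T$ with equal distance to $\mathbf x_{P_1}^0,\mathbf x_{P_2}^0,\mathbf x_{P_3}^0$, and with $$\Sigma=\{\mathbf z=(x,y,z)\in\mathbb{R}^3:\ \|\mathbf z-\mathbf c\|_2=\|\mathbf x_{P_1}^0-\mathbf c\|_2,\ (x,y,0)\in S,\ z>0\}$$ we have $$\mathcal B=\Sigma\setminus\{\mathbf x_{P_1}^0,\mathbf x_{P_2}^0,\mathbf x_{P_3}^0\},$$ $$\mathcal W_P=\{\mathbf z=(x,y,z)\in\mathbb{R}^3:\ \|\mathbf z-\mathbf c\|_2>\|\mathbf x_{P_1}^0-\mathbf c\|_2,\ (x,y,0)\in S,\ z>0\},$$ $$\mathcal W_E=\Omega_{\rm play}\setminus(\Sigma\cup\mathcal W_P).$$ -/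

import Mathlib

open MeasureTheory

noncomputable section

namespace ReachAvoid

/-- The game space `ℝ³` with the Euclidean norm; coordinates `0, 1, 2` are `x, y, z`. -/
abbrev Point : Type := EuclideanSpace ℝ (Fin 3)

/-- The target plane `z = 0`. -/
def targetPlane : Set Point := {q | q 2 = 0}

/-- The goal subspace `z < 0`. -/
def goalSpace : Set Point := {q | q 2 < 0}

/-- The play subspace `z > 0`. -/
def playSpace : Set Point := {q | 0 < q 2}

/-- Orthogonal projection onto the target plane. -/
def proj (q : Point) : Point := !₂[q 0, q 1, 0]

/-- Reflection in the target plane. -/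
def mirror (q : Point) : Point := !₂[q 0, q 1, -q 2]

/-- An (open-loop) control: a measurable choice of unit heading at each time. Only the values at
times `t ≥ 0` influence the game. -/
def Control : Type := {u : ℝ → Point // Measurable u ∧ ∀ t, ‖u t‖ = 1}

/-- The position at time `t` of a player that starts at `x₀` and uses the control `u`,
i.e. the solution of `ẋ = u`, `x(0) = x₀`. -/
def position (x₀ : Point) (u : Control) (t : ℝ) : Point := x₀ + ∫ s in (0 : ℝ)..t, u.1 s

/-- Two controls agree (almost everywhere) on the time interval `[0, t]`. -/
def AgreeUpTo (t : ℝ) (u v : Control) : Prop :=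
  ∀ᵐ s ∂(volume.restrict (Set.Icc 0 t)), u.1 s = v.1 s

/-- A strategy of the pursuit team (pursuers indexed by `ι`) assigns the controls of all pursuers
to the control of the evader. It is non-anticipative if the pursuers' controls up to time `t` depend
only on the evader's control up to time `t`. -/
def NonAnticipative {ι : Type} (γ : Control → ι → Control) : Prop :=
  ∀ (e e' : Control) (t : ℝ), 0 ≤ t → AgreeUpTo t e e' → ∀ i, AgreeUpTo t (γ e i) (γ e' i)

/-- A strategy of the evader assigns a control of the evader to the controls of the pursuers.
It is non-anticipative with delay if, for some reaction delay `τ > 0`, the evader's control up to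
time `t + τ` depends only on the pursuers' controls up to time `t`. -/
def NonAnticipativeWithDelay {ι : Type} (ε : (ι → Control) → Control) : Prop :=
  ∃ τ : ℝ, 0 < τ ∧ ∀ (p p' : ι → Control) (t : ℝ), 0 ≤ t →
    (∀ i, AgreeUpTo t (p i) (p' i)) → AgreeUpTo (t + τ) (ε p) (ε p')

/-- With initial positions `P` of the pursuers and `x` of the evader and with controls `p` and `e`,
some pursuer is at the position of the evader at time `t`. -/
def CapturedAt {ι : Type} (P : ι → Point) (x : Point) (p : ι → Control) (e : Control) (t : ℝ) :
    Prop :=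
  ∃ i, position (P i) (p i) t = position x e t

/-- The admissible initial positions of the evader: in the play subspace, and different from the
initial positions of the pursuers. -/
def admissible {ι : Type} (P : ι → Point) : Set Point := playSpace \ Set.range P

/-- The pursuer winning subspace: the pursuers have a non-anticipative strategy guaranteeing that,
whatever the evader does, the evader cannot reach the target plane without having been captured
strictly earlier. -/
def pursuerWinning {ι : Type} (P : ι → Point) : Set Point :=
  {x | x ∈ admissible P ∧ ∃ γ : Control → ι → Control, NonAnticipative γ ∧
    ∀ (e : Control) (t : ℝ), 0 ≤ t → position x e t ∈ targetPlane →
      ∃ s, 0 ≤ s ∧ s < t ∧ CapturedAt P x (γ e) e s}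

/-- The evader winning subspace: the evader has a strategy guaranteeing that, whatever the
pursuers do, it enters the goal subspace at some time without having been captured. -/
def evaderWinning {ι : Type} (P : ι → Point) : Set Point :=
  {x | x ∈ admissible P ∧ ∃ ε : (ι → Control) → Control, NonAnticipativeWithDelay ε ∧
    ∀ p : ι → Control, ∃ t, 0 ≤ t ∧ position x (ε p) t ∈ goalSpace ∧
      ∀ s, 0 ≤ s → s ≤ t → ¬ CapturedAt P x p (ε p) s}

/-- The barrier, which separates the two winning subspaces: the admissible initial positions from
which neither team can guarantee its own winning. -/
def barrier {ι : Type} (P : ι → Point) : Set Point :=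
  admissible P \ (pursuerWinning P ∪ evaderWinning P)

/-- The condition that all three pursuers are active: the projections of any two pursuers differ,
and neither the third pursuer nor its mirror image lies in the winning subspace of these two. -/
def AllActive (P : Fin 3 → Point) : Prop :=
  ∀ i j k : Fin 3, i ≠ j → k ≠ i → k ≠ j →
    (P i 0 - P j 0) ^ 2 + (P i 1 - P j 1) ^ 2 ≠ 0 ∧
      {P k, mirror (P k)} ∩ pursuerWinning ![P i, P j] = ∅

/-- The closed triangle in the target plane spanned by the projections of the pursuers. -/
def triangle (P : Fin 3 → Point) : Set Point :=
  convexHull ℝ (Set.range fun i => proj (P i))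

/-- `c` is a point of the target plane that has equal distance to all three pursuers. -/
def IsEquidistant (P : Fin 3 → Point) (c : Point) : Prop :=
  c ∈ targetPlane ∧ ∀ i j, ‖P i - c‖ = ‖P j - c‖

end ReachAvoid

end

namespace ReachAvoid

/-! ### Trajectories -/

/-! For an evader at `x` and a pursuer at `p`, `advantage x p` is affine and vanishes on their
bisector plane. A straight run to a target point where every advantage is nonnegative cannot be
intercepted on the way. Conversely, a pursuer mirroring the evader in the bisector captures it as
soon as it gets there. So the outcome depends only on the signs of the advantages at points with `z
≤ 0`. Above the triangle, weights expressing `proj x` through the projected pursuers make the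
averaged advantage at `q` equal to `‖P 0 - c‖ ^ 2 - ‖x - c‖ ^ 2` plus a multiple of the height of
`q` (`exists_advantage_le`), so the sphere about `c` decides. Off the triangle, a separating line
gives a horizontal direction in which all advantages grow (`exists_advantage_pos_of_proj_notMem`).
That the evader cannot win on the barrier also needs a play consistent with both strategies
(`exists_play`). -/

lemma Control.intervalIntegrable (u : Control) (a b : ℝ) :
    IntervalIntegrable u.1 volume a b := by
  refine (intervalIntegrable_const (c := (1 : ℝ))).mono_fun
    u.2.1.aestronglyMeasurable (Filter.Eventually.of_forall fun t => ?_)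
  simp [u.2.2 t]

lemma position_zero (x : Point) (u : Control) : position x u 0 = x := by
  simp [position]

lemma continuous_position (x : Point) (u : Control) : Continuous (position x u) :=
  continuous_const.add (intervalIntegral.continuous_primitive u.intervalIntegrable 0)

lemma norm_position_sub_le (x : Point) (u : Control) {t : ℝ} (ht : 0 ≤ t) :
    ‖position x u t - x‖ ≤ t := by
  have h := intervalIntegral.norm_integral_le_of_norm_le_const
    (a := 0) (b := t) (C := 1) (f := u.1) (fun s _ => (u.2.2 s).le)
  simpa [position, abs_of_nonneg ht] using h

lemma position_congr (x : Point) {u v : Control} {t : ℝ} (ht : 0 ≤ t) (h : AgreeUpTo t u v) :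
    position x u t = position x v t := by
  unfold position
  rw [intervalIntegral.integral_of_le ht, intervalIntegral.integral_of_le ht]
  congr 1
  exact integral_congr_ae (ae_restrict_of_ae_restrict_of_subset Set.Ioc_subset_Icc_self h)

lemma AgreeUpTo.mono {s t : ℝ} (hst : s ≤ t) {u v : Control} (h : AgreeUpTo t u v) :
    AgreeUpTo s u v :=
  ae_restrict_of_ae_restrict_of_subset (Set.Icc_subset_Icc_right hst) h

lemma AgreeUpTo.symm {t : ℝ} {u v : Control} (h : AgreeUpTo t u v) : AgreeUpTo t v u :=
  Filter.Eventually.mono h fun _ hs => hs.symm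

lemma AgreeUpTo.trans {t : ℝ} {u v w : Control} (h : AgreeUpTo t u v) (h' : AgreeUpTo t v w) :
    AgreeUpTo t u w := by
  filter_upwards [h, h'] with s hs hs' using hs.trans hs'

lemma agreeUpTo_zero (u v : Control) : AgreeUpTo 0 u v := by
  simp [AgreeUpTo]

/-- The control with constant heading `d`. -/
noncomputable def constControl (d : Point) (hd : ‖d‖ = 1) : Control :=
  ⟨fun _ => d, measurable_const, fun _ => hd⟩

lemma position_constControl (x d : Point) (hd : ‖d‖ = 1) (t : ℝ) :
    position x (constControl d hd) t = x + t • d := by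
  simp [position, constControl]

instance : Nonempty Control :=
  ⟨constControl (EuclideanSpace.single 0 1) (by simp)⟩

/-- The control obtained by applying a linear isometry to all headings. -/
noncomputable def mapControl (R : Point ≃ₗᵢ[ℝ] Point) (u : Control) : Control :=
  ⟨fun t => R (u.1 t), R.continuous.measurable.comp u.2.1, fun t => by simp [u.2.2 t]⟩

lemma position_mapControl (R : Point ≃ₗᵢ[ℝ] Point) (x y : Point) (u : Control) (t : ℝ) :
    position y (mapControl R u) t = y + R (position x u t - x) := by
  have h := (R.toContinuousLinearEquiv : Point →L[ℝ] Point).intervalIntegral_comp_comm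
    (u.intervalIntegrable 0 t)
  simpa [position, mapControl] using h

lemma AgreeUpTo.mapControl {t : ℝ} {u v : Control} (h : AgreeUpTo t u v)
    (R : Point ≃ₗᵢ[ℝ] Point) : AgreeUpTo t (mapControl R u) (mapControl R v) :=
  Filter.Eventually.mono h fun _ hs => congrArg R hs

/-! ### Playing a non-anticipative strategy against a delayed one -/

/-- Controls that agree on longer and longer intervals can be glued together. -/
lemma exists_control_agreeUpTo (e : ℕ → Control) {τ : ℝ} (hτ : 0 < τ)
    (h : ∀ n : ℕ, AgreeUpTo (n * τ) (e n) (e (n + 1))) :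
    ∃ u : Control, ∀ n : ℕ, AgreeUpTo (n * τ) u (e n) := by
  have hle : ∀ n k : ℕ, AgreeUpTo (n * τ) (e n) (e (n + k)) := by
    intro n k
    induction k with
    | zero => exact Filter.Eventually.of_forall fun _ => rfl
    | succ k ih =>
      refine ih.trans ((h (n + k)).mono ?_)
      push_cast
      nlinarith [Nat.cast_nonneg (α := ℝ) k]
  -- At time `t` follow `e n` for the least `n` with `t ≤ n * τ`.
  refine ⟨⟨fun t => (e ⌈t / τ⌉₊).1 t, ?_, fun t => (e _).2.2 t⟩, fun n => ?_⟩
  · exact (measurable_from_prod_countable_left (f := fun z : ℝ × ℕ => (e z.2).1 z.1)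
      fun m => (e m).2.1).comp
      (measurable_id.prodMk (Nat.measurable_ceil.comp (measurable_id.div_const τ)))
  · have hall : ∀ m k : ℕ, ∀ᵐ s : ℝ, s ∈ Set.Icc 0 (m * τ) → (e m).1 s = (e (m + k)).1 s :=
      fun m k => (ae_restrict_iff' measurableSet_Icc).1 (hle m k)
    refine (ae_restrict_iff' measurableSet_Icc).2 ?_
    filter_upwards [ae_all_iff.2 fun m => ae_all_iff.2 (hall m)] with s hs hsn
    have hm : s ≤ ⌈s / τ⌉₊ * τ := (div_le_iff₀ hτ).1 (Nat.le_ceil _)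
    have hmn : ⌈s / τ⌉₊ ≤ n := Nat.ceil_le.2 ((div_le_iff₀ hτ).2 hsn.2)
    obtain ⟨k, rfl⟩ := Nat.exists_eq_add_of_le hmn
    exact hs ⌈s / τ⌉₊ k ⟨hsn.1, hm⟩

/-- A non-anticipative strategy and a non-anticipative strategy with delay determine a play. -/
lemma exists_play {ι : Type} {γ : Control → ι → Control} (hγ : NonAnticipative γ)
    {ε : (ι → Control) → Control} (hε : NonAnticipativeWithDelay ε) :
    ∃ e : Control, ∀ t, AgreeUpTo t (ε (γ e)) e := by
  obtain ⟨τ, hτ, hε⟩ := hε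
  -- Each application of `ε ∘ γ` extends agreement by the delay `τ`, so the iterates stabilise on
  -- every bounded interval and the glued limit is a fixed point.
  let e : ℕ → Control := fun n => (fun u => ε (γ u))^[n] (Classical.arbitrary Control)
  have hsucc : ∀ n, e (n + 1) = ε (γ (e n)) := fun n => Function.iterate_succ_apply' _ _ _
  have hstep : ∀ (u v : Control) (n : ℕ), AgreeUpTo (n * τ) u v →
      AgreeUpTo ((n + 1 : ℕ) * τ) (ε (γ u)) (ε (γ v)) := by
    intro u v n huv
    have h0 : 0 ≤ n * τ := by positivity
    have := hε _ _ _ h0 fun i => hγ u v _ h0 huv i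
    convert this using 1
    push_cast
    ring
  have hagree : ∀ n : ℕ, AgreeUpTo (n * τ) (e n) (e (n + 1)) := by
    intro n
    induction n with
    | zero => simpa using agreeUpTo_zero _ _
    | succ n ih =>
      rw [hsucc (n + 1)]
      nth_rewrite 1 [hsucc n]
      exact hstep _ _ _ ih
  obtain ⟨u, hu⟩ := exists_control_agreeUpTo e hτ hagree
  refine ⟨u, fun t => ?_⟩
  obtain ⟨n, hn⟩ := exists_nat_ge (t / τ)
  have ht : t ≤ (n + 1 : ℕ) * τ := by
    rw [div_le_iff₀ hτ] at hn
    push_cast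
    linarith
  refine AgreeUpTo.mono ht ?_
  have h1 := hstep _ _ _ (hu n)
  rw [← hsucc] at h1
  exact h1.trans (hu (n + 1)).symm

/-! ### The advantage function -/

/-- The squared distance of `q` from `p` minus its squared distance from `x`, as an affine function
of `q`. It is positive where an evader at `x` arrives before a pursuer at `p`. -/
noncomputable def advantage (x p q : Point) : ℝ := ‖x - p‖ ^ 2 + 2 * inner ℝ (x - p) (q - x)

lemma advantage_eq (x p q : Point) : advantage x p q = ‖q - p‖ ^ 2 - ‖q - x‖ ^ 2 := by
  have h : q - p = (x - p) + (q - x) := by abel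
  rw [h, norm_add_sq_real, advantage]
  ring

lemma advantage_pos_self {x p : Point} (h : x ≠ p) : 0 < advantage x p x := by
  have : 0 < ‖x - p‖ := norm_pos_iff.2 (sub_ne_zero.2 h)
  simp only [advantage, sub_self, inner_zero_right, mul_zero, add_zero]
  positivity

lemma continuous_advantage (x p : Point) : Continuous (advantage x p) := by
  unfold advantage
  fun_prop

lemma advantage_ray (x p d : Point) (s : ℝ) :
    advantage x p (x + s • d) = ‖x - p‖ ^ 2 + 2 * s * inner ℝ (x - p) d := by
  simp only [advantage, add_sub_cancel_left, inner_smul_right]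
  ring

/-- Nobody intercepts an evader on a straight run before its advantage is used up. -/
lemma not_intercepted {x p d : Point} (hd : ‖d‖ = 1) (hxp : x ≠ p) {s r : ℝ} (hs : 0 ≤ s)
    (hsr : s < r) (hr : 0 ≤ advantage x p (x + r • d)) (u : Control) :
    position p u s ≠ x + s • d := by
  intro h
  have h1 : ‖x + s • d - p‖ ≤ s := h ▸ norm_position_sub_le p u hs
  have h2 : advantage x p (x + s • d) ≤ 0 := by
    rw [advantage_eq, add_sub_cancel_left, norm_smul, hd, Real.norm_of_nonneg hs]
    nlinarith [norm_nonneg (x + s • d - p)]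
  have h3 : 0 < ‖x - p‖ ^ 2 := by
    have : 0 < ‖x - p‖ := norm_pos_iff.2 (sub_ne_zero.2 hxp)
    positivity
  -- Along the ray the advantage is affine and starts positive; being `≤ 0` at `s`, it has negative
  -- slope and is negative at `r`.
  rw [advantage_ray] at hr h2
  have h4 : inner ℝ (x - p) d < 0 := by
    by_contra! h4
    nlinarith [mul_nonneg hs h4]
  nlinarith [mul_lt_mul_of_neg_right hsr h4]

/-- A point of the play space is joined to a point of the target plane by a unit-speed run that
descends. -/
lemma exists_heading {x q : Point} (hx : x ∈ playSpace) (hq : q ∈ targetPlane) :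
    ∃ (d : Point) (r : ℝ), ‖d‖ = 1 ∧ 0 < r ∧ x + r • d = q ∧ d 2 < 0 := by
  have hx : 0 < x 2 := hx
  have hq : q 2 = 0 := hq
  have hne : q - x ≠ 0 := by
    intro h
    rw [sub_eq_zero] at h
    rw [h] at hq
    exact hx.ne' hq
  have hr : 0 < ‖q - x‖ := norm_pos_iff.2 hne
  refine ⟨‖q - x‖⁻¹ • (q - x), ‖q - x‖, ?_, hr, ?_, ?_⟩
  · rw [norm_smul, norm_inv, norm_norm, inv_mul_cancel₀ hr.ne']
  · rw [smul_smul, mul_inv_cancel₀ hr.ne', one_smul, add_sub_cancel]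
  · have : 0 < ‖q - x‖⁻¹ * x 2 := by positivity
    simp only [PiLp.smul_apply, PiLp.sub_apply, smul_eq_mul, hq]
    linarith

/-- The pursuers do not win if some target point is not closer to any of them than to the
evader. -/
lemma notMem_pursuerWinning {ι : Type} {P : ι → Point} {x q : Point} (hq : q ∈ targetPlane)
    (h : ∀ i, 0 ≤ advantage x (P i) q) : x ∉ pursuerWinning P := by
  rintro ⟨⟨hx, hxP⟩, γ, -, hγ⟩
  obtain ⟨d, r, hd, hr, rfl, -⟩ := exists_heading hx hq
  obtain ⟨s, hs, hsr, i, hi⟩ := hγ (constControl d hd) r hr.le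
    (by rwa [position_constControl])
  rw [position_constControl] at hi
  exact not_intercepted hd (fun e => hxP ⟨i, e.symm⟩) hs hsr (h i) _ hi

/-- The evader wins if some target point is closer to it than to every pursuer. -/
lemma mem_evaderWinning {ι : Type} [Finite ι] {P : ι → Point} {x q : Point}
    (hx : x ∈ admissible P) (hq : q ∈ targetPlane) (h : ∀ i, 0 < advantage x (P i) q) :
    x ∈ evaderWinning P := by
  obtain ⟨d, r, hd, hr, rfl, hd2⟩ := exists_heading hx.1 hq
  have hev : ∀ᶠ r' in nhdsWithin r (Set.Ioi r), ∀ i, 0 < advantage x (P i) (x + r' • d) := by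
    refine Filter.eventually_all.2 fun i => nhdsWithin_le_nhds ?_
    have hc : Continuous fun r' : ℝ => advantage x (P i) (x + r' • d) :=
      (continuous_advantage x (P i)).comp (by fun_prop)
    exact hc.continuousAt.eventually (lt_mem_nhds (h i))
  -- The run is stopped midway between `r` and `r'`: past the plane, yet strictly before the
  -- advantages are known to last.
  obtain ⟨r', hr', hrr'⟩ := (hev.and self_mem_nhdsWithin).exists
  have hrr' : r < r' := hrr'
  refine ⟨hx, fun _ => constControl d hd,
    ⟨1, one_pos, fun _ _ _ _ _ => Filter.Eventually.of_forall fun _ => rfl⟩, fun p =>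
    ⟨(r + r') / 2, by linarith, ?_, ?_⟩⟩
  · have hq : x 2 + r * d 2 = 0 := by simpa [targetPlane] using hq
    rw [position_constControl]
    change (x + ((r + r') / 2) • d) 2 < 0
    simp only [PiLp.add_apply, PiLp.smul_apply, smul_eq_mul]
    nlinarith [mul_lt_mul_of_neg_right hrr' hd2]
  · rintro s hs hst ⟨i, hi⟩
    rw [position_constControl] at hi
    exact not_intercepted hd (fun e => hx.2 ⟨i, e.symm⟩) hs (by linarith) (hr' i).le _ hi

/-! ### The reflection strategy -/

/-- Each pursuer mirrors the evader in the bisector of their initial positions. -/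
noncomputable def reflectionStrategy {ι : Type} (P : ι → Point) (x : Point) (e : Control) (i : ι) : Control :=
  mapControl (Submodule.span ℝ {x - P i})ᗮ.reflection e

lemma nonAnticipative_reflectionStrategy {ι : Type} (P : ι → Point) (x : Point) :
    NonAnticipative (reflectionStrategy P x) :=
  fun _ _ _ _ h _ => h.mapControl _

lemma capturedAt_reflectionStrategy {ι : Type} {P : ι → Point} {x : Point} {e : Control}
    {t : ℝ} {i : ι} (hi : x ≠ P i) (h : advantage x (P i) (position x e t) = 0) :
    CapturedAt P x (reflectionStrategy P x e) e t := by
  refine ⟨i, ?_⟩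
  have hv : ‖x - P i‖ ≠ 0 := norm_ne_zero_iff.2 (sub_ne_zero.2 hi)
  rw [reflectionStrategy, position_mapControl _ x, Submodule.reflection_orthogonal_apply,
    Submodule.reflection_singleton_apply]
  -- The reflection subtracts this multiple of `x - P i` from the displacement; the value `-1`
  -- exactly makes up the initial offset.
  have h' : 2 * (inner ℝ (x - P i) (position x e t - x) / ‖x - P i‖ ^ 2) = -1 := by
    rw [advantage] at h
    field_simp
    linarith
  have h2 : 2 • (inner ℝ (x - P i) (position x e t - x) / ((‖x - P i‖ : ℝ) : ℝ) ^ 2) • (x - P i)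
      = -(x - P i) := by
    rw [← Nat.cast_smul_eq_nsmul ℝ, smul_smul, Nat.cast_ofNat, h', neg_one_smul]
  erw [h2]
  abel

/-- Against the reflection strategy, the evader is captured by the time it has lost its advantage
over a pursuer. -/
lemma exists_capturedAt_reflectionStrategy {ι : Type} {P : ι → Point} {x : Point} {e : Control}
    {t : ℝ} (ht : 0 ≤ t) {i : ι} (hi : x ≠ P i)
    (h : advantage x (P i) (position x e t) ≤ 0) :
    ∃ s, 0 ≤ s ∧ s ≤ t ∧ advantage x (P i) (position x e s) = 0 ∧
      CapturedAt P x (reflectionStrategy P x e) e s := by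
  have hc : Continuous fun s => advantage x (P i) (position x e s) :=
    (continuous_advantage x (P i)).comp (continuous_position x e)
  have h0 : 0 ≤ advantage x (P i) (position x e 0) := by
    rw [position_zero]
    exact (advantage_pos_self hi).le
  obtain ⟨s, hs, hs0⟩ := intermediate_value_Icc' ht hc.continuousOn ⟨h, h0⟩
  exact ⟨s, hs.1, hs.2, hs0, capturedAt_reflectionStrategy hi hs0⟩

/-- The pursuers win if no point of the target plane is at least as close to the evader as to all
pursuers. -/
lemma mem_pursuerWinning {ι : Type} {P : ι → Point} {x : Point} (hx : x ∈ admissible P)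
    (h : ∀ q ∈ targetPlane, ∃ i, advantage x (P i) q < 0) : x ∈ pursuerWinning P := by
  refine ⟨hx, reflectionStrategy P x, nonAnticipative_reflectionStrategy P x,
    fun e t ht hq => ?_⟩
  obtain ⟨i, hi⟩ := h _ hq
  obtain ⟨s, hs, hst, hs0, hcap⟩ :=
    exists_capturedAt_reflectionStrategy ht (fun e => hx.2 ⟨i, e.symm⟩) hi.le
  refine ⟨s, hs, lt_of_le_of_ne hst ?_, hcap⟩
  rintro rfl
  exact hi.ne hs0

/-- The evader does not win if no goal point is closer to it than to all pursuers. -/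
lemma notMem_evaderWinning {ι : Type} {P : ι → Point} {x : Point}
    (h : ∀ q ∈ goalSpace, ∃ i, advantage x (P i) q ≤ 0) : x ∉ evaderWinning P := by
  rintro ⟨hx, ε, hε, hwin⟩
  obtain ⟨e, he⟩ := exists_play (nonAnticipative_reflectionStrategy P x) hε
  obtain ⟨t, ht, hgoal, hfree⟩ := hwin (reflectionStrategy P x e)
  rw [position_congr x ht (he t)] at hgoal
  obtain ⟨i, hi⟩ := h _ hgoal
  obtain ⟨s, hs, hst, -, j, hj⟩ :=
    exists_capturedAt_reflectionStrategy ht (fun e => hx.2 ⟨i, e.symm⟩) hi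
  refine hfree s hs hst ⟨j, ?_⟩
  rw [hj, position_congr x hs (he s)]

/-! ### Geometry of the three pursuers -/

lemma inner_eq_coords (u v : Point) : inner ℝ u v = u 0 * v 0 + u 1 * v 1 + u 2 * v 2 := by
  simp only [PiLp.inner_apply, Fin.sum_univ_three]
  simp [mul_comm]

lemma norm_sq_eq_coords (u : Point) : ‖u‖ ^ 2 = u 0 ^ 2 + u 1 ^ 2 + u 2 ^ 2 := by
  rw [← real_inner_self_eq_norm_sq, inner_eq_coords]
  ring

/-- Above the triangle, the advantages over the pursuers have a convex combination that depends on
the height only. -/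
lemma exists_advantage_le {P : Fin 3 → Point} {c x q : Point} (hc : IsEquidistant P c)
    (hx : proj x ∈ triangle P) (hxpos : 0 < x 2) (hxP : x ∉ Set.range P)
    (hle : ‖P 0 - c‖ ≤ ‖x - c‖) (hq : q 2 ≤ 0) :
    ∃ i, advantage x (P i) q ≤ ‖P 0 - c‖ ^ 2 - ‖x - c‖ ^ 2 := by
  rw [triangle, convexHull_range_eq_exists_affineCombination] at hx
  obtain ⟨s, w, hw0, hw1, hwx⟩ := hx
  rw [s.affineCombination_eq_linear_combination _ _ hw1] at hwx
  have hcoord : ∀ k : Fin 3, ∑ i ∈ s, w i * proj (P i) k = proj x k := by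
    intro k
    rw [← hwx]
    simp [Finset.sum_apply]
  have h0 : ∑ i ∈ s, w i * P i 0 = x 0 := by simpa [proj] using hcoord 0
  have h1 : ∑ i ∈ s, w i * P i 1 = x 1 := by simpa [proj] using hcoord 1
  set A := ‖P 0 - c‖ ^ 2 - ‖x - c‖ ^ 2 with hA
  set B := x 2 - ∑ i ∈ s, w i * P i 2 with hB
  have hc2 : c 2 = 0 := hc.1
  have hadv : ∀ (y : Point) (i : Fin 3), advantage x (P i) y = A +
      2 * ((y 0 - c 0) * (x 0 - P i 0) + (y 1 - c 1) * (x 1 - P i 1)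
        + y 2 * (x 2 - P i 2)) := by
    intro y i
    rw [hA, hc.2 0 i, advantage, norm_sq_eq_coords, norm_sq_eq_coords, norm_sq_eq_coords,
      inner_eq_coords]
    simp only [PiLp.sub_apply, hc2]
    ring
  -- The horizontal terms cancel because the weights average the projections to `proj x`.
  have hsum : ∀ y : Point, ∑ i ∈ s, w i * advantage x (P i) y = A + 2 * (y 2 * B) := by
    intro y
    have hterm : ∀ i ∈ s, w i * advantage x (P i) y =
        w i * (A + 2 * ((y 0 - c 0) * x 0 + (y 1 - c 1) * x 1 + y 2 * x 2))
        - 2 * (y 0 - c 0) * (w i * P i 0) - 2 * (y 1 - c 1) * (w i * P i 1)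
        - 2 * y 2 * (w i * P i 2) := by
      intro i _
      rw [hadv]
      ring
    rw [Finset.sum_congr rfl hterm]
    simp only [Finset.sum_sub_distrib, ← Finset.mul_sum, ← Finset.sum_mul]
    rw [hw1, h0, h1, hB]
    ring
  have hApos : A ≤ 0 := by
    have := pow_le_pow_left₀ (norm_nonneg _) hle 2
    linarith
  -- At `y = x` all advantages are positive, which with `A ≤ 0` and `0 < x 2` excludes `B < 0`.
  have hBpos : 0 ≤ B := by
    have hself : 0 ≤ ∑ i ∈ s, w i * advantage x (P i) x := Finset.sum_nonneg fun i hi =>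
      mul_nonneg (hw0 i hi) (advantage_pos_self fun e => hxP ⟨i, e.symm⟩).le
    rw [hsum] at hself
    by_contra! hB
    nlinarith [mul_neg_of_pos_of_neg hxpos hB]
  by_contra! hcon
  have hgt : ∑ i ∈ s, w i * A < ∑ i ∈ s, w i * advantage x (P i) q := by
    refine Finset.sum_lt_sum (fun i hi => mul_le_mul_of_nonneg_left (hcon i).le (hw0 i hi)) ?_
    by_contra! hzero
    have : ∑ i ∈ s, w i ≤ 0 := Finset.sum_nonpos fun i hi => by
      by_contra! hpos
      exact (hzero i hi).not_gt (mul_lt_mul_of_pos_left (hcon i) hpos)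
    linarith
  rw [hsum, ← Finset.sum_mul, hw1] at hgt
  nlinarith [mul_nonpos_of_nonpos_of_nonneg hq hBpos]

/-- If the evader is not above the triangle, it has an advantage over all pursuers at some target
point. -/
lemma exists_advantage_pos_of_proj_notMem {P : Fin 3 → Point} {x : Point}
    (hx : proj x ∉ triangle P) :
    ∃ q ∈ targetPlane, ∀ i, 0 < advantage x (P i) q := by
  have hclosed : IsClosed (triangle P) :=
    (Set.finite_range fun i => proj (P i)).isClosed_convexHull ℝ
  obtain ⟨f, u, hf, hu⟩ := geometric_hahn_banach_closed_point (convex_convexHull ℝ _) hclosed hx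
  set g : Point := (InnerProductSpace.toDual ℝ Point).symm f with hg
  have hgf : ∀ y, g 0 * y 0 + g 1 * y 1 + g 2 * y 2 = f y := fun y => by
    rw [← inner_eq_coords, hg, InnerProductSpace.toDual_symm_apply]
  -- Only the horizontal part of the separating normal matters, since all projections have height
  -- zero.
  have hpos : ∀ i, 0 < inner ℝ (x - P i) (proj g) := by
    intro i
    have h1 : f (proj (P i)) < f (proj x) :=
      (hf _ (subset_convexHull ℝ _ ⟨i, rfl⟩)).trans hu
    rw [← hgf, ← hgf] at h1
    rw [inner_eq_coords]
    simp [proj] at h1 ⊢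
    linarith
  have hev : ∀ᶠ k : ℝ in Filter.atTop, ∀ i, 0 < advantage x (P i) (proj x + k • proj g) := by
    refine Filter.eventually_all.2 fun i => ?_
    have heq : ∀ k : ℝ, advantage x (P i) (proj x + k • proj g) =
        advantage x (P i) (proj x) + k * (2 * inner ℝ (x - P i) (proj g)) := by
      intro k
      rw [advantage, advantage, add_sub_right_comm, inner_add_right, inner_smul_right]
      ring
    simp only [heq]
    exact (Filter.tendsto_atTop_add_const_left _ _ (Filter.tendsto_id.atTop_mul_const
      (mul_pos two_pos (hpos i)))).eventually_gt_atTop 0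
  obtain ⟨k, hk⟩ := hev.exists
  exact ⟨_, by simp [targetPlane, proj], hk⟩

/-- Inside the sphere, `c` itself is nearer to the evader than to every pursuer. -/
lemma exists_advantage_pos {P : Fin 3 → Point} {c x : Point} (hc : IsEquidistant P c)
    (h : ¬ (proj x ∈ triangle P ∧ ‖P 0 - c‖ ≤ ‖x - c‖)) :
    ∃ q ∈ targetPlane, ∀ i, 0 < advantage x (P i) q := by
  by_cases hx : proj x ∈ triangle P
  · refine ⟨c, hc.1, fun i => ?_⟩
    have hlt : ‖x - c‖ < ‖P 0 - c‖ := not_le.1 fun hle => h ⟨hx, hle⟩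
    rw [advantage_eq, norm_sub_rev c, norm_sub_rev c, hc.2 i 0]
    have := pow_lt_pow_left₀ hlt (norm_nonneg _) two_ne_zero
    linarith
  · exact exists_advantage_pos_of_proj_notMem hx

/-! ### The equidistant point -/

lemma proj_det_ne_zero {P : Fin 3 → Point}
    (h : ¬ Collinear ℝ (Set.range fun i => proj (P i))) :
    (P 1 0 - P 0 0) * (P 2 1 - P 0 1) - (P 1 1 - P 0 1) * (P 2 0 - P 0 0) ≠ 0 := by
  intro hdet
  apply h
  rw [collinear_iff_of_mem (Set.mem_range_self (f := fun i => proj (P i)) 0)]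
  have hext : ∀ y z : Point, y 0 = z 0 → y 1 = z 1 → y 2 = z 2 → y = z := by
    intro y z h0 h1 h2
    ext k
    fin_cases k <;> assumption
  by_cases ha : P 1 0 - P 0 0 = 0
  · by_cases hb : P 1 1 - P 0 1 = 0
    · refine ⟨proj (P 2) - proj (P 0), ?_⟩
      rintro _ ⟨i, rfl⟩
      fin_cases i
      · exact ⟨0, by simp⟩
      · exact ⟨0, hext _ _ (by simp [proj]; linarith) (by simp [proj]; linarith)
          (by simp [proj])⟩
      · exact ⟨1, by simp⟩
    · refine ⟨proj (P 1) - proj (P 0), ?_⟩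
      rintro _ ⟨i, rfl⟩
      fin_cases i
      · exact ⟨0, by simp⟩
      · exact ⟨1, by simp⟩
      · refine ⟨(P 2 1 - P 0 1) / (P 1 1 - P 0 1), hext _ _ ?_ ?_ (by simp [proj])⟩
        · simp [proj]
          field_simp
          linarith
        · simp [proj]
          field_simp
          ring
  · refine ⟨proj (P 1) - proj (P 0), ?_⟩
    rintro _ ⟨i, rfl⟩
    fin_cases i
    · exact ⟨0, by simp⟩
    · exact ⟨1, by simp⟩
    · refine ⟨(P 2 0 - P 0 0) / (P 1 0 - P 0 0), hext _ _ ?_ ?_ (by simp [proj])⟩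
      · simp [proj]
        field_simp
        ring
      · simp [proj]
        field_simp
        linarith

/-- Squaring the distances cancels `‖c‖ ^ 2` and leaves a linear system in `c 0`, `c 1`. -/
lemma isEquidistant_iff {P : Fin 3 → Point} {c : Point} :
    IsEquidistant P c ↔ c 2 = 0 ∧
      2 * ((P 1 0 - P 0 0) * c 0 + (P 1 1 - P 0 1) * c 1) = ‖P 1‖ ^ 2 - ‖P 0‖ ^ 2 ∧
      2 * ((P 2 0 - P 0 0) * c 0 + (P 2 1 - P 0 1) * c 1) = ‖P 2‖ ^ 2 - ‖P 0‖ ^ 2 := by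
  have hiff : c 2 = 0 → ∀ i, ‖P i - c‖ = ‖P 0 - c‖ ↔
      2 * ((P i 0 - P 0 0) * c 0 + (P i 1 - P 0 1) * c 1) = ‖P i‖ ^ 2 - ‖P 0‖ ^ 2 := by
    intro hc i
    rw [← sq_eq_sq₀ (norm_nonneg _) (norm_nonneg _)]
    simp only [norm_sq_eq_coords, PiLp.sub_apply, hc]
    constructor <;> intro h <;> linarith
  constructor
  · rintro ⟨hc, h⟩
    exact ⟨hc, (hiff hc 1).1 (h 1 0), (hiff hc 2).1 (h 2 0)⟩
  · rintro ⟨hc, h1, h2⟩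
    have h0 : ∀ i, ‖P i - c‖ = ‖P 0 - c‖ := by
      intro i
      fin_cases i
      · rfl
      · exact (hiff hc 1).2 h1
      · exact (hiff hc 2).2 h2
    exact ⟨hc, fun i j => (h0 i).trans (h0 j).symm⟩

lemma existsUnique_isEquidistant {P : Fin 3 → Point}
    (h : ¬ Collinear ℝ (Set.range fun i => proj (P i))) : ∃! c, IsEquidistant P c := by
  have hdet := proj_det_ne_zero h
  simp only [isEquidistant_iff]
  generalize P 1 0 - P 0 0 = a₁ at hdet ⊢
  generalize P 1 1 - P 0 1 = b₁ at hdet ⊢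
  generalize P 2 0 - P 0 0 = a₂ at hdet ⊢
  generalize P 2 1 - P 0 1 = b₂ at hdet ⊢
  generalize ‖P 1‖ ^ 2 - ‖P 0‖ ^ 2 = r₁
  generalize ‖P 2‖ ^ 2 - ‖P 0‖ ^ 2 = r₂
  -- Cramer's rule.
  refine ⟨!₂[(r₁ * b₂ - r₂ * b₁) / (2 * (a₁ * b₂ - b₁ * a₂)),
    (a₁ * r₂ - a₂ * r₁) / (2 * (a₁ * b₂ - b₁ * a₂)), 0], ⟨by simp, ?_, ?_⟩, ?_⟩
  · simp
    field_simp
    ring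
  · simp
    rw [mul_div_assoc', mul_div_assoc', ← add_div, mul_div_assoc', div_eq_iff (by simpa using hdet)]
    ring
  · rintro y ⟨hy, h1, h2⟩
    ext k
    fin_cases k
    · simp
      rw [eq_div_iff (by simpa using hdet), ← h1, ← h2]
      ring
    · simp
      rw [eq_div_iff (by simpa using hdet), ← h1, ← h2]
      ring
    · simpa using hy

end ReachAvoid

open ReachAvoid in
theorem theorem3 (P : Fin 3 → ReachAvoid.Point) (hactive : ReachAvoid.AllActive P)
    (hncol : ¬ Collinear ℝ (Set.range fun i => ReachAvoid.proj (P i))) :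
    (∃! c, ReachAvoid.IsEquidistant P c) ∧
    ∀ c, ReachAvoid.IsEquidistant P c →
      ReachAvoid.barrier P =
        {q | ‖q - c‖ = ‖P 0 - c‖ ∧ ReachAvoid.proj q ∈ ReachAvoid.triangle P ∧ 0 < q 2}
          \ Set.range P ∧
      ReachAvoid.pursuerWinning P =
        {q | ‖q - c‖ > ‖P 0 - c‖ ∧ ReachAvoid.proj q ∈ ReachAvoid.triangle P ∧ 0 < q 2} ∧
      ReachAvoid.evaderWinning P =
        ReachAvoid.playSpace \
          ({q | ‖q - c‖ = ‖P 0 - c‖ ∧ ReachAvoid.proj q ∈ ReachAvoid.triangle P ∧ 0 < q 2} ∪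
           {q | ‖q - c‖ > ‖P 0 - c‖ ∧ ReachAvoid.proj q ∈ ReachAvoid.triangle P ∧ 0 < q 2}) := by
  refine ⟨existsUnique_isEquidistant hncol, fun c hc => ?_⟩
  have hP : ∀ i, proj (P i) ∈ triangle P := fun i => subset_convexHull ℝ _ ⟨i, rfl⟩
  have hpursuer : pursuerWinning P =
      {q | ‖q - c‖ > ‖P 0 - c‖ ∧ proj q ∈ triangle P ∧ 0 < q 2} := by
    ext q
    refine ⟨fun hq => ?_, fun ⟨hr, hS, hz⟩ => ?_⟩
    · have hr : proj q ∈ triangle P ∧ ‖P 0 - c‖ ≤ ‖q - c‖ := by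
        by_contra h
        obtain ⟨y, hy, hadv⟩ := exists_advantage_pos hc h
        exact notMem_pursuerWinning hy (fun i => (hadv i).le) hq
      refine ⟨lt_of_le_of_ne hr.2 fun heq => ?_, hr.1, hq.1.1⟩
      -- On the sphere all advantages vanish at `c`, so a straight run to `c` is not captured
      -- strictly before arrival.
      refine notMem_pursuerWinning hc.1 (fun i => ?_) hq
      rw [advantage_eq, norm_sub_rev c, norm_sub_rev c, hc.2 i 0, heq, sub_self]
    · have hqP : q ∉ Set.range P := by
        rintro ⟨i, rfl⟩
        exact hr.ne' (hc.2 i 0)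
      refine mem_pursuerWinning ⟨hz, hqP⟩ fun y hy => ?_
      obtain ⟨i, hi⟩ := exists_advantage_le hc hS hz hqP (le_of_lt hr) (le_of_eq hy)
      refine ⟨i, hi.trans_lt ?_⟩
      have := pow_lt_pow_left₀ hr (norm_nonneg _) two_ne_zero
      linarith
  have hevader : evaderWinning P = playSpace \
      ({q | ‖q - c‖ = ‖P 0 - c‖ ∧ proj q ∈ triangle P ∧ 0 < q 2} ∪
        {q | ‖q - c‖ > ‖P 0 - c‖ ∧ proj q ∈ triangle P ∧ 0 < q 2}) := by
    ext q
    refine ⟨fun hq => ⟨hq.1.1, fun hmem => ?_⟩, fun ⟨hz, hmem⟩ => ?_⟩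
    · have hr : ‖P 0 - c‖ ≤ ‖q - c‖ ∧ proj q ∈ triangle P := by
        rcases hmem with ⟨h, hS, -⟩ | ⟨h, hS, -⟩
        · exact ⟨h.ge, hS⟩
        · exact ⟨le_of_lt h, hS⟩
      refine notMem_evaderWinning (fun y hy => ?_) hq
      obtain ⟨i, hi⟩ := exists_advantage_le hc hr.2 hq.1.1 hq.1.2 hr.1 (le_of_lt hy)
      have := pow_le_pow_left₀ (norm_nonneg _) hr.1 2
      exact ⟨i, by linarith⟩
    · have hnot : ¬ (proj q ∈ triangle P ∧ ‖P 0 - c‖ ≤ ‖q - c‖) := by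
        rintro ⟨hS, hr⟩
        rcases hr.eq_or_lt with h | h
        · exact hmem (Or.inl ⟨h.symm, hS, hz⟩)
        · exact hmem (Or.inr ⟨h, hS, hz⟩)
      -- The pursuers lie on the sphere and project into the triangle, so the complement is
      -- automatically admissible.
      have hqP : q ∉ Set.range P := by
        rintro ⟨i, rfl⟩
        exact hnot ⟨hP i, (hc.2 0 i).le⟩
      obtain ⟨y, hy, hadv⟩ := exists_advantage_pos hc hnot
      exact mem_evaderWinning ⟨hz, hqP⟩ hy hadv
  refine ⟨?_, hpursuer, hevader⟩
  rw [barrier, hpursuer, hevader]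
  ext q
  constructor
  · rintro ⟨⟨hz, hqP⟩, hnot⟩
    refine ⟨?_, hqP⟩
    by_contra h
    exact hnot (or_iff_not_imp_left.2 fun h' => ⟨hz, fun h'' => h''.elim h h'⟩)
  · rintro ⟨h, hqP⟩
    refine ⟨⟨h.2.2, hqP⟩, ?_⟩
    rintro (h' | h')
    · exact h'.1.ne' h.1
    · exact h'.2 (Or.inl h)
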